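/- **Lemma 2.9.** Let $(A,\mathfrak m)$ be an Artinian local ring with infinite residue field, $S=\bigoplus_{n\ge 0}S_n$ a finitely generated standard graded $A$-algebra (that is, $S$ is generated over $A$ by $S_1$), $S_+=\bigoplus_{n>0}S_n$, and $M=\bigoplus_{n\ge 0}M_n$ a finitely generated graded $S$-module such that $S_1\not\subseteq\sqrt{\mathrm{Ann}_S M}$. Assume that $\dim M=1$. An ideal $J$ of $S$ generated by elements of degree $1$ is called a reduction of $S_+$ with respect to $M$ if $(JM)_n=M_n$ for all large $n$; for a reduction $J$, let $r_J(S_+;M)$ be the least integer $n$ such that $(JM)_{m+1}=M_{m+1}$ for all $m\ge n$. A reduction is minimal if it does not properly contain any other reduction of $S_+$ with respect to $M$. Let $$r=r(S_+;M)=\min\{\,r_J(S_+;M)\mid J \text{ is a minimal reduction of } S_+ \text{ with respect to } M\,\},$$ let $0_M:S_+^\infty=\bigcup_{n\ge 0}(0_M:S_+^n)$, and let $M^*=M/(0_M:S_+^\infty)$ with the induced grading. Then, with $\ell_A$ denoting length over $A$: (i) $\ell_A(M^*_n)=\ell_A(M^*_r)$ for all $n\ge r$; (ii) $\ell_A(M_n)=\ell_A(M^*_r)$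 for all large $n$. -/

import Mathlib

namespace GradedReduction

section General

variable {S : Type*} [CommRing S] {M : Type*} [AddCommGroup M] [Module S M]

/-- The submodule `0_M : I^∞ = ⋃ₙ (0_M : Iⁿ)`. -/
def zeroColonInfty (I : Ideal S) (M : Type*) [AddCommGroup M] [Module S M] : Submodule S M where
  carrier := {m | ∃ n : ℕ, ∀ a ∈ I ^ n, a • m = 0}
  zero_mem' := ⟨0, fun a _ => smul_zero a⟩
  add_mem' := by
    rintro x y ⟨n, hn⟩ ⟨k, hk⟩
    refine ⟨max n k, fun a ha => ?_⟩
    rw [smul_add, hn a (Ideal.pow_le_pow_right (le_max_left n k) ha),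
      hk a (Ideal.pow_le_pow_right (le_max_right n k) ha), add_zero]
  smul_mem' := by
    rintro c x ⟨n, hn⟩
    refine ⟨n, fun a ha => ?_⟩
    rw [smul_comm, hn a ha, smul_zero]

end General

section Graded

variable {A S M : Type*} [CommRing A] [CommRing S] [Algebra A S]
  [AddCommGroup M] [Module A M] [Module S M] [IsScalarTower A S M]

/-- The degree `n` piece `N_n = N ∩ M_n` of an `S`-submodule `N` of `M = ⨁ M_n`, as an
`A`-module. -/
def piece (ℳ : ℕ → Submodule A M) (N : Submodule S M) (n : ℕ) : Submodule A M :=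
  N.restrictScalars A ⊓ ℳ n

/-- The degree `n` piece `(M/N)_n` of the quotient `M/N` with its induced grading: the image
of `M_n`. -/
def quotientPiece (ℳ : ℕ → Submodule A M) (N : Submodule S M) (n : ℕ) : Submodule A (M ⧸ N) :=
  (ℳ n).map (N.mkQ.restrictScalars A)

/-- `J` is a reduction of `S_+` with respect to `M`: it is generated by elements of degree `1`
and `(JM)_n = M_n` for all large `n`. -/
def IsReduction (𝒮 : ℕ → Submodule A S) (ℳ : ℕ → Submodule A M) (J : Ideal S) : Prop :=
  (∃ T : Set S, T ⊆ (𝒮 1 : Set S) ∧ J = Ideal.span T) ∧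
    ∀ᶠ n in Filter.atTop, piece ℳ (J • (⊤ : Submodule S M)) n = ℳ n

/-- A minimal reduction: a reduction that does not properly contain another reduction. -/
def IsMinimalReduction (𝒮 : ℕ → Submodule A S) (ℳ : ℕ → Submodule A M) (J : Ideal S) : Prop :=
  IsReduction 𝒮 ℳ J ∧ ∀ J' : Ideal S, IsReduction 𝒮 ℳ J' → ¬ J' < J

/-- `r_J(S_+; M)`: the least `n` from which on `(JM)_{m+1} = M_{m+1}`. -/
noncomputable def reductionNumberOf (ℳ : ℕ → Submodule A M) (J : Ideal S) : ℕ :=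
  sInf {n : ℕ | ∀ m, n ≤ m → piece ℳ (J • (⊤ : Submodule S M)) (m + 1) = ℳ (m + 1)}

/-- `r(S_+; M)`: the minimum of `r_J(S_+; M)` over the minimal reductions `J`. -/
noncomputable def reductionNumber (𝒮 : ℕ → Submodule A S) (ℳ : ℕ → Submodule A M) : ℕ :=
  sInf {r : ℕ | ∃ J : Ideal S, IsMinimalReduction 𝒮 ℳ J ∧ r = reductionNumberOf ℳ J}

/-- The degree `n` piece of `M* = M / (0_M : S_+^∞)`. -/
noncomputable def starPiece (𝒮 : ℕ → Submodule A S) [GradedAlgebra 𝒮]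
    (ℳ : ℕ → Submodule A M) (n : ℕ) :
    Submodule A (M ⧸ zeroColonInfty (HomogeneousIdeal.irrelevant 𝒮).toIdeal M) :=
  quotientPiece ℳ (zeroColonInfty (HomogeneousIdeal.irrelevant 𝒮).toIdeal M) n

end Graded

end GradedReduction

namespace GradedReduction

open DirectSum

/-! ### Homogeneous components in standard graded algebras and modules -/

section Components

variable {A S M : Type*} [CommRing A] [CommRing S] [Algebra A S] [AddCommGroup M] [Module A M]
  [Module S M]
  (𝒮 : ℕ → Submodule A S)
  (ℳ : ℕ → Submodule A M) [DirectSum.Decomposition ℳ] [SetLike.GradedSMul 𝒮 ℳ]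

/-! In dimension one a minimal reduction is principal, `J = (x)` with `x` of degree one and `S_+ ⊆
√(Ann M + (x))` (`IsMinimalReduction.exists_eq_span_singleton`): prime avoidance over the infinite
residue field finds such an `x` inside any reduction, and it already generates a reduction. The
radical condition identifies `0_M : S_+^∞` with the `x`-power torsion of `M`
(`mem_zeroColonInfty_iff`), so `x` acts injectively on `M*`. If `J` attains `r`, then `M_{n+1} = x
M_n` for `n ≥ r`. Hence `x : M*_n → M*_{n+1}` is bijective for these `n`, which gives (i). For (ii),
the torsion is killed by a single `x^K`, yet in degrees at least `r + K` each torsion element is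
`x^K` times another torsion element. So it vanishes there and `M_n ≅ M*_n`
(`exists_forall_mem_eq_zero`). -/

variable {𝒮} in
theorem decompose_smul_of_left_mem {i : ℕ} {a : S} (ha : a ∈ 𝒮 i) (m : M) (n : ℕ) :
    (decompose ℳ (a • m) (i + n) : M) = a • (decompose ℳ m n : M) := by
  induction m using Decomposition.inductionOn ℳ with
  | zero => simp
  | @homogeneous j m =>
    have h : a • (m : M) ∈ ℳ (i + j) := SetLike.GradedSMul.smul_mem ha m.2
    by_cases hj : j = n
    · subst hj
      rw [decompose_of_mem_same ℳ h, decompose_of_mem_same ℳ m.2]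
    · rw [decompose_of_mem_ne ℳ h (by omega), decompose_of_mem_ne ℳ m.2 hj, smul_zero]
  | add m m' hm hm' =>
    simp only [smul_add, decompose_add, DirectSum.add_apply, Submodule.coe_add, hm, hm']

variable {𝒮 ℳ} in
theorem exists_smul_eq_of_mem_span_singleton_smul_top {x : S} (hx : x ∈ 𝒮 1) {n : ℕ} {m : M}
    (hm : m ∈ ℳ (n + 1)) (h : m ∈ Ideal.span {x} • (⊤ : Submodule S M)) :
    ∃ m' ∈ ℳ n, x • m' = m := by
  rw [Submodule.ideal_span_singleton_smul] at h
  obtain ⟨y, -, rfl⟩ := (Submodule.mem_smul_pointwise_iff_exists _ _ _).1 h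
  refine ⟨decompose ℳ y n, SetLike.coe_mem _, ?_⟩
  rw [← decompose_smul_of_left_mem ℳ hx, add_comm 1 n, decompose_of_mem_same ℳ hm]

variable [GradedAlgebra 𝒮]

variable {ℳ} in
theorem decompose_smul_of_right_mem {e : ℕ} {m : M} (hm : m ∈ ℳ e) (a : S) (i : ℕ) :
    (decompose ℳ (a • m) (i + e) : M) = (decompose 𝒮 a i : S) • m := by
  induction a using Decomposition.inductionOn 𝒮 with
  | zero => simp
  | @homogeneous j a =>
    have h : (a : S) • m ∈ ℳ (j + e) := SetLike.GradedSMul.smul_mem a.2 hm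
    by_cases hj : j = i
    · subst hj
      rw [decompose_of_mem_same ℳ h, decompose_of_mem_same 𝒮 a.2]
    · rw [decompose_of_mem_ne ℳ h (by omega), decompose_of_mem_ne 𝒮 a.2 hj, zero_smul]
  | add a b ha hb =>
    simp only [add_smul, decompose_add, DirectSum.add_apply, Submodule.coe_add, ha, hb]

variable {𝒮}

theorem annihilator_isHomogeneous (ℳ : ℕ → Submodule A M) [DirectSum.Decomposition ℳ]
    [SetLike.GradedSMul 𝒮 ℳ] : (Module.annihilator S M).IsHomogeneous 𝒮 := by
  intro i a ha
  rw [Module.mem_annihilator] at ha ⊢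
  intro m
  induction m using Decomposition.inductionOn ℳ with
  | zero => simp
  | @homogeneous j m => simp [← decompose_smul_of_right_mem 𝒮 m.2, ha]
  | add m m' hm hm' => rw [smul_add, hm, hm', add_zero]

theorem decompose_mem_span_pow (h𝒮 : Algebra.adjoin A (𝒮 1 : Set S) = ⊤) (s : S) (n : ℕ) :
    (decompose 𝒮 s n : S) ∈ Ideal.span (𝒮 1 : Set S) ^ n := by
  have hs : s ∈ Submodule.span A (Submonoid.closure (𝒮 1 : Set S) : Set S) := by
    rw [← Algebra.adjoin_eq_span, h𝒮]
    trivial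
  induction hs using Submodule.span_induction generalizing n with
  | mem s hs =>
    obtain ⟨k, hk, hk'⟩ : ∃ k, s ∈ 𝒮 k ∧ s ∈ Ideal.span (𝒮 1 : Set S) ^ k := by
      induction hs using Submonoid.closure_induction with
      | mem s hs => exact ⟨1, hs, by simpa using Ideal.subset_span hs⟩
      | one => exact ⟨0, SetLike.GradedOne.one_mem, by simp⟩
      | mul s t _ _ hs ht =>
        obtain ⟨k, hk, hk'⟩ := hs
        obtain ⟨l, hl, hl'⟩ := ht
        exact ⟨k + l, SetLike.GradedMul.mul_mem hk hl, by
          rw [pow_add]; exact Ideal.mul_mem_mul hk' hl'⟩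
    by_cases h : k = n
    · subst h
      rwa [decompose_of_mem_same 𝒮 hk]
    · rw [decompose_of_mem_ne 𝒮 hk h]
      exact zero_mem _
  | zero => simp
  | add s t _ _ hs ht => simpa using add_mem (hs n) (ht n)
  | smul a s _ hs =>
    rw [decompose_smul, DirectSum.smul_apply, Submodule.coe_smul, Algebra.smul_def]
    exact Ideal.mul_mem_left _ _ (hs n)

theorem irrelevant_eq_span_degree_one (h𝒮 : Algebra.adjoin A (𝒮 1 : Set S) = ⊤) :
    (HomogeneousIdeal.irrelevant 𝒮).toIdeal = Ideal.span (𝒮 1 : Set S) := by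
  refine le_antisymm ?_ (Ideal.span_le.2 fun s hs =>
    HomogeneousIdeal.mem_irrelevant_of_mem 𝒮 one_pos hs)
  rw [HomogeneousIdeal.toIdeal_irrelevant_le]
  intro i hi s hs
  have := decompose_mem_span_pow h𝒮 s i
  rw [decompose_of_mem_same 𝒮 hs] at this
  exact Ideal.pow_le_self hi.ne' this

/-- Projection to degree zero is a ring homomorphism that kills `𝒮 1` and fixes scalars, so on an
algebra generated in degree one its values are scalars. -/
theorem exists_algebraMap_eq_of_mem_zero (h𝒮 : Algebra.adjoin A (𝒮 1 : Set S) = ⊤) {s : S}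
    (hs : s ∈ 𝒮 0) : ∃ a : A, algebraMap A S a = s := by
  have key : ∀ s : S, ∃ a : A, algebraMap A S a = GradedRing.projZeroRingHom 𝒮 s := by
    intro s
    have hs : s ∈ Algebra.adjoin A (𝒮 1 : Set S) := h𝒮 ▸ Algebra.mem_top
    induction hs using Algebra.adjoin_induction with
    | mem s hs =>
      exact ⟨0, by rw [map_zero, GradedRing.projZeroRingHom_apply,
        decompose_of_mem_ne 𝒮 hs one_ne_zero]⟩
    | algebraMap a =>
      exact ⟨a, by rw [GradedRing.projZeroRingHom_apply,
        decompose_of_mem_same 𝒮 (SetLike.algebraMap_mem_graded 𝒮 a)]⟩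
    | add s t _ _ hs ht =>
      obtain ⟨a, ha⟩ := hs
      obtain ⟨b, hb⟩ := ht
      exact ⟨a + b, by rw [map_add, map_add, ha, hb]⟩
    | mul s t _ _ hs ht =>
      obtain ⟨a, ha⟩ := hs
      obtain ⟨b, hb⟩ := ht
      exact ⟨a * b, by rw [map_mul, map_mul, ha, hb]⟩
  obtain ⟨a, ha⟩ := key s
  exact ⟨a, by rw [ha, GradedRing.projZeroRingHom_apply, decompose_of_mem_same 𝒮 hs]⟩

/-- A finitely generated graded module `M` over a standard graded Noetherian algebra satisfies `M_n ⊆ S_+ ^ k M` for all large `n`. -/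
theorem eventually_mem_span_pow_smul_top [IsNoetherian S M]
    (h𝒮 : Algebra.adjoin A (𝒮 1 : Set S) = ⊤) (k : ℕ) :
    ∃ d, ∀ n, d ≤ n → ∀ m ∈ ℳ n, m ∈ Ideal.span (𝒮 1 : Set S) ^ k • (⊤ : Submodule S M) := by
  set N := Ideal.span (𝒮 1 : Set S) ^ k • (⊤ : Submodule S M)
  -- Quantifying over all multiples `s • m` makes `C d` a submodule. The chain exhausts `M`, so once
  -- it stabilizes one `d` serves every element.
  let C : ℕ →o Submodule S M :=
    { toFun d :=
        { carrier := {m | ∀ s : S, ∀ n, d ≤ n → (decompose ℳ (s • m) n : M) ∈ N}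
          zero_mem' := by intro s n _; simp
          add_mem' := by
            intro m m' hm hm' s n hn
            simpa using add_mem (hm s n hn) (hm' s n hn)
          smul_mem' := by
            intro c m hm s n hn
            rw [← mul_smul]
            exact hm _ n hn }
      monotone' := fun d d' h m hm s n hn => hm s n (h.trans hn) }
  obtain ⟨d, hd⟩ := monotone_stabilizes_iff_noetherian.2 ‹IsNoetherian S M› C
  have hC : ∀ m, ∃ d, m ∈ C d := by
    intro m
    induction m using Decomposition.inductionOn ℳ with
    | zero => exact ⟨0, zero_mem _⟩
    | @homogeneous e m =>
      refine ⟨k + e, fun s n hn => ?_⟩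
      obtain ⟨j, rfl⟩ := Nat.exists_eq_add_of_le hn
      rw [show k + e + j = (k + j) + e by omega, decompose_smul_of_right_mem 𝒮 m.2]
      exact Submodule.smul_mem_smul (Ideal.pow_le_pow_right (Nat.le_add_right k j)
        (decompose_mem_span_pow h𝒮 s (k + j))) trivial
    | add m m' hm hm' =>
      obtain ⟨a, ha⟩ := hm
      obtain ⟨b, hb⟩ := hm'
      exact ⟨max a b, add_mem (C.monotone (le_max_left a b) ha) (C.monotone (le_max_right a b) hb)⟩
  refine ⟨d, fun n hn m hm => ?_⟩
  obtain ⟨e, he⟩ := hC m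
  have hmd : m ∈ C d := by
    rcases le_total e d with h | h
    · exact C.monotone h he
    · rwa [hd e h]
  simpa [decompose_of_mem_same ℳ hm] using hmd 1 n hn

end Components

/-! ### Avoidance of finitely many submodules -/

section Avoidance

/-- A module over a local ring with infinite residue field that lies in none of finitely many
submodules is not covered by them. -/
theorem exists_mem_forall_notMem_of_infinite_residueField {A E : Type*} [CommRing A]
    [IsLocalRing A] [Infinite (IsLocalRing.ResidueField A)] [AddCommGroup E] [Module A E]
    (V : Submodule A E) (s : Finset (Submodule A E)) (hs : ∀ N ∈ s, ¬ V ≤ N) :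
    ∃ x ∈ V, ∀ N ∈ s, x ∉ N := by
  classical
  induction s using Finset.induction_on with
  | empty => exact ⟨0, zero_mem _, by simp⟩
  | insert P s _ ih =>
    obtain ⟨x, hxV, hx⟩ := ih fun N hN => hs N (Finset.mem_insert_of_mem hN)
    obtain ⟨v, hvV, hv⟩ := SetLike.not_le_iff_exists.1 (hs P (Finset.mem_insert_self P s))
    by_contra! hcon
    -- Pigeonhole on the line `x + f a • v`, with `f` lifting residue classes: two distinct classes
    -- land in the same submodule, and `f a - f b` is a unit, so that submodule contains both `v`
    -- and `x`.
    obtain ⟨f, hf⟩ := IsLocalRing.residue_surjective (R := A).hasRightInverse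
    have hbad : ∀ a : IsLocalRing.ResidueField A, ∃ N : (insert P s : Finset _),
        x + f a • v ∈ N.1 := fun a => by
      obtain ⟨N, hN, h⟩ := hcon _ (add_mem hxV (V.smul_mem (f a) hvV))
      exact ⟨⟨N, hN⟩, h⟩
    choose g hg using hbad
    obtain ⟨a, b, hab, hgab⟩ := Finite.exists_ne_map_eq_of_infinite g
    have hunit : IsUnit (f a - f b) := by
      rw [← IsLocalRing.residue_ne_zero_iff_isUnit, map_sub, hf a, hf b]
      exact sub_ne_zero.2 hab
    have hvN : v ∈ (g a).1 := by
      have := sub_mem (hg a) (hgab ▸ hg b)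
      rw [add_sub_add_left_eq_sub, ← sub_smul] at this
      exact (Submodule.smul_mem_iff_of_isUnit _ hunit).1 this
    have hxN : x ∈ (g a).1 := (Submodule.add_mem_iff_left _ (Submodule.smul_mem _ _ hvN)).1 (hg a)
    rcases Finset.mem_insert.1 (g a).2 with h | h
    · exact hv (h ▸ hvN)
    · exact hx _ h hxN

end Avoidance

/-! ### Primes of the support in dimension at most one -/

section Dimension

variable {A S M : Type*} [CommRing A] [CommRing S] [Algebra A S] [AddCommGroup M] [Module A M]
  [Module S M]
  {𝒮 : ℕ → Submodule A S} [GradedAlgebra 𝒮]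

/-- If a prime `Q ⊇ Ann M + (x)` missed part of `S_+`, its homogeneous core `q` would sit in a chain
`P < q < 𝔐` in `Supp M`, with `P` a minimal prime of `Ann M`. The first inclusion is strict because
`x ∈ q` but `x ∉ P`, the second because `𝔐 ⊇ S_+`. -/
theorem irrelevant_le_radical_of_forall_minimalPrimes [Module.Finite S M]
    (ℳ : ℕ → Submodule A M) [DirectSum.Decomposition ℳ] [SetLike.GradedSMul 𝒮 ℳ]
    (hdim : Module.supportDim S M ≤ 1) {i : ℕ} {x : S} (hx : x ∈ 𝒮 i)
    (hP : ∀ P ∈ (Module.annihilator S M).minimalPrimes,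
      ¬ (HomogeneousIdeal.irrelevant 𝒮).toIdeal ≤ P → x ∉ P) :
    (HomogeneousIdeal.irrelevant 𝒮).toIdeal ≤
      (Module.annihilator S M ⊔ Ideal.span {x}).radical := by
  rw [Ideal.radical_eq_sInf]
  refine le_sInf ?_
  rintro Q ⟨hQ, hQprime⟩
  have hann := annihilator_isHomogeneous (𝒮 := 𝒮) ℳ
  set q := (Q.homogeneousCore 𝒮).toIdeal with hq
  have hqQ : q ≤ Q := Q.toIdeal_homogeneousCore_le 𝒮
  have hqprime : q.IsPrime := hQprime.homogeneousCore
  have hannq : Module.annihilator S M ≤ q := by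
    rw [← hann.toIdeal_homogeneousCore_eq_self]
    exact Ideal.homogeneousCore_mono 𝒮 (le_sup_left.trans hQ)
  have hxq : x ∈ q := Ideal.mem_homogeneousCore_of_homogeneous_of_mem ⟨i, hx⟩
    (hQ (Ideal.mem_sup_right (Ideal.mem_span_singleton_self x)))
  obtain ⟨P, hPmin, hPq⟩ := Ideal.exists_minimalPrimes_le hannq
  by_cases hPirr : (HomogeneousIdeal.irrelevant 𝒮).toIdeal ≤ P
  · exact hPirr.trans (hPq.trans hqQ)
  have hPlt : P < q := lt_of_le_of_ne hPq fun h => hP P hPmin hPirr (h ▸ hxq)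
  -- This is the prime `(Q ∩ S_0) ⊕ S_+`.
  set 𝔐 := Q.comap (GradedRing.projZeroRingHom 𝒮) with h𝔐
  have hirr : (HomogeneousIdeal.irrelevant 𝒮).toIdeal ≤ 𝔐 := by
    rw [HomogeneousIdeal.toIdeal_irrelevant]
    exact Ideal.ker_le_comap _
  have hq𝔐 : q ≤ 𝔐 := fun s hs => hqQ ((Q.homogeneousCore 𝒮).isHomogeneous 0 hs)
  by_contra hirrQ
  have hlt : q < 𝔐 := lt_of_le_of_ne hq𝔐 fun h => hirrQ (hirr.trans (h ▸ hqQ))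
  have hPprime : P.IsPrime := hPmin.1.1
  have h𝔐prime : 𝔐.IsPrime := inferInstance
  have hsupp : ∀ {p : Ideal S} (hp : p.IsPrime), Module.annihilator S M ≤ p →
      (⟨p, hp⟩ : PrimeSpectrum S) ∈ Module.support S M := fun hp h =>
    Module.mem_support_iff_of_finite.2 h
  let c : LTSeries (Module.support S M) :=
    { length := 2
      toFun := ![⟨⟨P, hPprime⟩, hsupp _ hPmin.1.2⟩, ⟨⟨q, hqprime⟩, hsupp _ hannq⟩,
        ⟨⟨𝔐, h𝔐prime⟩, hsupp _ (hannq.trans hq𝔐)⟩]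
      step := by
        intro j
        fin_cases j
        · exact hPlt
        · exact hlt }
  have h2 : (2 : WithBot ℕ∞) ≤ Module.supportDim S M := le_iSup (α := WithBot ℕ∞)
    (fun c : LTSeries (Module.support S M) => (c.length : WithBot ℕ∞)) c
  exact absurd (h2.trans hdim) (by decide)

end Dimension

/-! ### Reductions and their principal generators -/

section Reductions

variable {A S M : Type*} [CommRing A] [CommRing S] [Algebra A S] [AddCommGroup M] [Module A M]
  [Module S M] [IsScalarTower A S M]
  {𝒮 : ℕ → Submodule A S} {ℳ : ℕ → Submodule A M}

theorem piece_eq_iff {N : Submodule S M} {n : ℕ} : piece ℳ N n = ℳ n ↔ ∀ m ∈ ℳ n, m ∈ N := by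
  rw [piece, inf_eq_right]
  rfl

theorem IsReduction.exists_forall_mem {J : Ideal S} (hJ : IsReduction 𝒮 ℳ J) :
    ∃ d, ∀ n, d ≤ n → ∀ m ∈ ℳ n, m ∈ J • (⊤ : Submodule S M) := by
  obtain ⟨d, hd⟩ := Filter.eventually_atTop.1 hJ.2
  exact ⟨d, fun n hn => piece_eq_iff.1 (hd n hn)⟩

theorem smul_mem_span_singleton_smul_top {x a : S}
    (ha : a ∈ Module.annihilator S M ⊔ Ideal.span {x}) (m : M) :
    a • m ∈ Ideal.span {x} • (⊤ : Submodule S M) := by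
  obtain ⟨b, hb, c, hc, rfl⟩ := Submodule.mem_sup.1 ha
  rw [add_smul, Module.mem_annihilator.1 hb m, zero_add]
  exact Submodule.smul_mem_smul hc trivial

/-- A power of `I` lies in `Ann M + (x)`, and `(Ann M + (x))^(1+K) ⊆ Ann M + (x^K)`. The resulting
exponent does not depend on `m`. -/
theorem exists_pow_forall_smul_eq_zero [IsNoetherianRing S] {I : Ideal S} {x : S}
    (hI : I ≤ (Module.annihilator S M ⊔ Ideal.span {x}).radical) (K : ℕ) :
    ∃ k, ∀ m : M, x ^ K • m = 0 → ∀ a ∈ I ^ k, a • m = 0 := by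
  obtain ⟨k, hk⟩ := Ideal.exists_pow_le_of_le_radical_of_fg hI (IsNoetherian.noetherian I)
  refine ⟨k * (1 + K), fun m hm a ha => ?_⟩
  have hle : (Module.annihilator S M ⊔ Ideal.span {x}) ^ (1 + K) ≤
      Module.annihilator S M ⊔ Ideal.span {x ^ K} := by
    simpa [Ideal.span_singleton_pow] using
      Ideal.sup_pow_add_le_pow_sup_pow (I := Module.annihilator S M) (J := Ideal.span {x})
        (n := 1) (m := K)
  rw [pow_mul] at ha
  obtain ⟨b, hb, c, hc, rfl⟩ := Submodule.mem_sup.1 (hle (Ideal.pow_right_mono hk _ ha))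
  obtain ⟨c, rfl⟩ := Ideal.mem_span_singleton'.1 hc
  rw [add_smul, Module.mem_annihilator.1 hb m, zero_add, mul_smul, hm, smul_zero]

theorem mem_zeroColonInfty_iff [IsNoetherianRing S] {I : Ideal S} {x : S} (hx : x ∈ I)
    (hI : I ≤ (Module.annihilator S M ⊔ Ideal.span {x}).radical) {m : M} :
    m ∈ zeroColonInfty I M ↔ ∃ K : ℕ, x ^ K • m = 0 := by
  refine ⟨fun ⟨K, hK⟩ => ⟨K, hK _ (Ideal.pow_mem_pow hx K)⟩, fun ⟨K, hK⟩ => ?_⟩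
  obtain ⟨k, hk⟩ := exists_pow_forall_smul_eq_zero (M := M) hI K
  exact ⟨k, hk m hK⟩

variable [GradedAlgebra 𝒮] [DirectSum.Decomposition ℳ] [SetLike.GradedSMul 𝒮 ℳ]

/-- Such a `P` lies in `Supp (M/JM)`. Since `M/JM` vanishes in large degrees, a power of each `s ∈ 𝒮
1` annihilates it and hence belongs to `P`. -/
theorem IsReduction.irrelevant_le_of_le [Module.Finite S M]
    (h𝒮 : Algebra.adjoin A (𝒮 1 : Set S) = ⊤) {J P : Ideal S} (hJ : IsReduction 𝒮 ℳ J)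
    (hP : P.IsPrime) (hann : Module.annihilator S M ≤ P) (hJP : J ≤ P) :
    (HomogeneousIdeal.irrelevant 𝒮).toIdeal ≤ P := by
  rw [irrelevant_eq_span_degree_one h𝒮, Ideal.span_le]
  intro s hs
  obtain ⟨d, hd⟩ := hJ.exists_forall_mem
  have hsupp : (⟨P, hP⟩ : PrimeSpectrum S) ∈
      Module.support S (M ⧸ (J • ⊤ : Submodule S M)) := by
    rw [Module.support_quotient]
    exact ⟨Module.mem_support_iff_of_finite.2 hann, hJP⟩
  refine hP.mem_of_pow_mem d (Module.mem_support_iff_of_finite.1 hsupp ?_)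
  rw [Module.mem_annihilator]
  intro y
  obtain ⟨m, rfl⟩ := Submodule.Quotient.mk_surjective _ y
  rw [← Submodule.Quotient.mk_smul, Submodule.Quotient.mk_eq_zero]
  induction m using Decomposition.inductionOn ℳ with
  | zero => simp
  | @homogeneous j m =>
    have hsd : s ^ d ∈ 𝒮 (d * 1) := by simpa using SetLike.pow_mem_graded d hs
    exact hd (d * 1 + j) (by omega) _ (SetLike.GradedSMul.smul_mem hsd m.2)
  | add m m' hm hm' =>
    rw [smul_add]
    exact add_mem hm hm'

theorem isReduction_span_singleton [IsNoetherianRing S] [IsNoetherian S M]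
    (h𝒮 : Algebra.adjoin A (𝒮 1 : Set S) = ⊤) {x : S} (hx : x ∈ 𝒮 1)
    (hrad : (HomogeneousIdeal.irrelevant 𝒮).toIdeal ≤
      (Module.annihilator S M ⊔ Ideal.span {x}).radical) :
    IsReduction 𝒮 ℳ (Ideal.span {x}) := by
  refine ⟨⟨{x}, by simpa using hx, rfl⟩, ?_⟩
  rw [irrelevant_eq_span_degree_one h𝒮] at hrad
  obtain ⟨k, hk⟩ := Ideal.exists_pow_le_of_le_radical_of_fg hrad (IsNoetherian.noetherian _)
  obtain ⟨d, hd⟩ := eventually_mem_span_pow_smul_top ℳ h𝒮 k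
  refine Filter.eventually_atTop.2 ⟨d, fun n hn => piece_eq_iff.2 fun m hm => ?_⟩
  have hle : Ideal.span (𝒮 1 : Set S) ^ k • (⊤ : Submodule S M) ≤ Ideal.span {x} • ⊤ :=
    Submodule.smul_le.2 fun a ha m _ => smul_mem_span_singleton_smul_top (hk ha) m
  exact hle (hd n hn m hm)

theorem isReduction_span_degree_one [IsNoetherian S M]
    (h𝒮 : Algebra.adjoin A (𝒮 1 : Set S) = ⊤) : IsReduction 𝒮 ℳ (Ideal.span (𝒮 1 : Set S)) := by
  refine ⟨⟨_, subset_rfl, rfl⟩, ?_⟩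
  obtain ⟨d, hd⟩ := eventually_mem_span_pow_smul_top ℳ h𝒮 1
  rw [pow_one] at hd
  exact Filter.eventually_atTop.2 ⟨d, fun n hn => piece_eq_iff.2 (hd n hn)⟩

/-- In dimension one every reduction contains a linear form that cuts `Supp M` down to `V(S_+)`. -/
theorem IsReduction.exists_mem_irrelevant_le_radical [IsLocalRing A]
    [Infinite (IsLocalRing.ResidueField A)] [IsNoetherianRing S] [Module.Finite S M]
    (h𝒮 : Algebra.adjoin A (𝒮 1 : Set S) = ⊤) (hdim : Module.supportDim S M ≤ 1)
    {J : Ideal S} (hJ : IsReduction 𝒮 ℳ J) :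
    ∃ x ∈ 𝒮 1, x ∈ J ∧ (HomogeneousIdeal.irrelevant 𝒮).toIdeal ≤
      (Module.annihilator S M ⊔ Ideal.span {x}).radical := by
  classical
  obtain ⟨T, hT, rfl⟩ := hJ.1
  have hfin := (Module.annihilator S M).finite_minimalPrimes_of_isNoetherianRing S
  -- Avoidance is applied over `A`, to the `A`-span of the generators `T`, so that `x` stays in
  -- degree one. The reduction is contained in none of these primes.
  let s : Finset (Submodule A S) :=
    (hfin.toFinset.filter fun P => ¬ (HomogeneousIdeal.irrelevant 𝒮).toIdeal ≤ P).image
      (Submodule.restrictScalars A)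
  obtain ⟨x, hxV, hx⟩ := exists_mem_forall_notMem_of_infinite_residueField
    (Submodule.span A T) s (by
      simp only [s, Finset.mem_image, Finset.mem_filter, Set.Finite.mem_toFinset]
      rintro _ ⟨P, ⟨hP, hPirr⟩, rfl⟩ hle
      refine hPirr (hJ.irrelevant_le_of_le h𝒮 hP.1.1 hP.1.2 (Ideal.span_le.2 ?_))
      exact fun t ht => hle (Submodule.subset_span ht))
  have hx1 : x ∈ 𝒮 1 := Submodule.span_le.2 hT hxV
  refine ⟨x, hx1, Submodule.span_le_restrictScalars A S T hxV, ?_⟩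
  refine irrelevant_le_radical_of_forall_minimalPrimes ℳ hdim hx1 fun P hP hPirr hxP => ?_
  refine hx (P.restrictScalars A) ?_ hxP
  simp only [s, Finset.mem_image, Finset.mem_filter, Set.Finite.mem_toFinset]
  exact ⟨P, ⟨hP, hPirr⟩, rfl⟩

theorem IsMinimalReduction.exists_eq_span_singleton [IsLocalRing A]
    [Infinite (IsLocalRing.ResidueField A)] [IsNoetherianRing S] [Module.Finite S M]
    (h𝒮 : Algebra.adjoin A (𝒮 1 : Set S) = ⊤) (hdim : Module.supportDim S M ≤ 1)
    {J : Ideal S} (hJ : IsMinimalReduction 𝒮 ℳ J) :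
    ∃ x ∈ 𝒮 1, J = Ideal.span {x} ∧ (HomogeneousIdeal.irrelevant 𝒮).toIdeal ≤
      (Module.annihilator S M ⊔ Ideal.span {x}).radical := by
  have : IsNoetherian S M := isNoetherian_of_isNoetherianRing_of_finite S M
  obtain ⟨x, hx, hxJ, hrad⟩ := hJ.1.exists_mem_irrelevant_le_radical h𝒮 hdim
  refine ⟨x, hx, ?_, hrad⟩
  have hle : Ideal.span {x} ≤ J := (Ideal.span_singleton_le_iff_mem J).2 hxJ
  exact (eq_of_le_of_not_lt hle (hJ.2 _ (isReduction_span_singleton h𝒮 hx hrad))).symm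

/-- A reduction inside `(x)` contains some `y = a x` with `a ∈ A` and `S_+ ⊆ √(Ann M + (y))`. If `a`
is a unit, the reduction is all of `(x)`. Otherwise `a` is nilpotent because `A` is Artinian local,
and then `S_+ ⊆ √(Ann M)`, contrary to `hS₁`. -/
theorem exists_isMinimalReduction [IsArtinianRing A] [IsLocalRing A]
    [Infinite (IsLocalRing.ResidueField A)] [IsNoetherianRing S] [Module.Finite S M]
    (h𝒮 : Algebra.adjoin A (𝒮 1 : Set S) = ⊤) (hdim : Module.supportDim S M ≤ 1)
    (hS₁ : ¬ (𝒮 1 : Set S) ⊆ ((Module.annihilator S M).radical : Set S)) :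
    ∃ J, IsMinimalReduction 𝒮 ℳ J := by
  have : IsNoetherian S M := isNoetherian_of_isNoetherianRing_of_finite S M
  obtain ⟨x, hx, -, hrad⟩ := (isReduction_span_degree_one (ℳ := ℳ)
    h𝒮).exists_mem_irrelevant_le_radical h𝒮 hdim
  refine ⟨_, isReduction_span_singleton h𝒮 hx hrad, fun J hJ hlt => ?_⟩
  obtain ⟨y, hy, hyJ, hyrad⟩ := hJ.exists_mem_irrelevant_le_radical h𝒮 hdim
  obtain ⟨c, hc⟩ := Ideal.mem_span_singleton'.1 (hlt.le hyJ)
  obtain ⟨a, ha⟩ := exists_algebraMap_eq_of_mem_zero h𝒮 (SetLike.coe_mem (decompose 𝒮 c 0))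
  have hyx : y = algebraMap A S a * x := by
    have := coe_decompose_mul_add_of_right_mem 𝒮 (i := 0) (a := c) hx
    rwa [hc, zero_add, decompose_of_mem_same 𝒮 hy, ← ha] at this
  by_cases hunit : IsUnit a
  · refine hlt.not_ge ((Ideal.span_singleton_le_iff_mem J).2 ?_)
    rw [hyx] at hyJ
    exact (Ideal.unit_mul_mem_iff_mem J (hunit.map (algebraMap A S))).1 hyJ
  · obtain ⟨n, hn⟩ : IsNilpotent a := by
      obtain ⟨n, hn⟩ := IsArtinianRing.isNilpotent_jacobson_bot (R := A)
      rw [IsLocalRing.jacobson_eq_maximalIdeal ⊥ bot_ne_top] at hn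
      exact ⟨n, by simpa [hn] using
        Ideal.pow_mem_pow ((IsLocalRing.mem_maximalIdeal a).2 hunit) n⟩
    refine hS₁ fun s hs => ?_
    have hy0 : Ideal.span {y} ≤ (Module.annihilator S M).radical := by
      rw [Ideal.span_singleton_le_iff_mem]
      refine ⟨n, ?_⟩
      rw [hyx, mul_pow, ← map_pow, hn, map_zero, zero_mul]
      exact zero_mem _
    have hle := hyrad.trans (Ideal.radical_mono (sup_le Ideal.le_radical hy0))
    rw [Ideal.radical_idem] at hle
    exact hle (HomogeneousIdeal.mem_irrelevant_of_mem 𝒮 one_pos hs)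

end Reductions

/-! ### Lengths of graded pieces of a quotient -/

section Length

variable {A S M : Type*} [CommRing A] [CommRing S] [Algebra A S] [AddCommGroup M] [Module A M]
  [Module S M] [IsScalarTower A S M]
  {𝒮 : ℕ → Submodule A S} {ℳ : ℕ → Submodule A M} [SetLike.GradedSMul 𝒮 ℳ]

/-- Multiplication by `x` is an isomorphism between the two pieces: `hN` makes it injective on `M ⧸
N`, and `hsurj` makes it surjective. -/
theorem length_quotientPiece_succ {N : Submodule S M} {x : S} (hx : x ∈ 𝒮 1)
    (hN : ∀ m : M, x • m ∈ N → m ∈ N) {n : ℕ}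
    (hsurj : ∀ m ∈ ℳ (n + 1), ∃ m' ∈ ℳ n, x • m' = m) :
    Module.length A (quotientPiece ℳ N (n + 1)) = Module.length A (quotientPiece ℳ N n) := by
  let f : (M ⧸ N) →ₗ[A] (M ⧸ N) := (LinearMap.lsmul S (M ⧸ N) x).restrictScalars A
  have hf : Function.Injective f := by
    rw [← LinearMap.ker_eq_bot, LinearMap.ker_eq_bot']
    intro y hy
    obtain ⟨m, rfl⟩ := Submodule.Quotient.mk_surjective _ y
    have hy' : Submodule.Quotient.mk (p := N) (x • m) = 0 := hy
    rw [Submodule.Quotient.mk_eq_zero] at hy' ⊢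
    exact hN m hy'
  have hmap : quotientPiece ℳ N (n + 1) = (quotientPiece ℳ N n).map f := by
    apply le_antisymm
    · rintro _ ⟨m, hm, rfl⟩
      obtain ⟨m', hm', rfl⟩ := hsurj m hm
      exact ⟨_, ⟨m', hm', rfl⟩, rfl⟩
    · rintro _ ⟨_, ⟨m, hm, rfl⟩, rfl⟩
      refine ⟨x • m, ?_, rfl⟩
      have := SetLike.GradedSMul.smul_mem (A := 𝒮) (B := ℳ) hx hm
      rwa [vadd_eq_add, add_comm] at this
  rw [hmap]
  exact (Submodule.equivMapOfInjective f hf _).length_eq.symm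

theorem length_quotientPiece_eq {N : Submodule S M} {n : ℕ} (hN : ∀ m ∈ ℳ n, m ∈ N → m = 0) :
    Module.length A (quotientPiece ℳ N n) = Module.length A (ℳ n) := by
  let f : M →ₗ[A] (M ⧸ N) := N.mkQ.restrictScalars A
  refine (LinearEquiv.ofBijective (f.submoduleMap (ℳ n)) ⟨?_, ?_⟩).length_eq.symm
  · rw [← LinearMap.ker_eq_bot, LinearMap.ker_eq_bot']
    intro m hm
    have hm' : Submodule.Quotient.mk (p := N) (m : M) = 0 := congrArg Subtype.val hm
    exact Subtype.ext (hN m m.2 ((Submodule.Quotient.mk_eq_zero N).1 hm'))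
  · exact f.submoduleMap_surjective (ℳ n)

end Length

/-! ### Vanishing of torsion in large degrees -/

section Torsion

theorem exists_forall_mem_eq_zero {A S M : Type*} [CommRing A] [CommRing S] [AddCommGroup M]
    [Module A M] [Module S M] [IsNoetherian S M] {ℳ : ℕ → Submodule A M} {N : Submodule S M} {x : S} {r : ℕ}
    (hN : ∀ m ∈ N, ∃ K : ℕ, x ^ K • m = 0) (hN' : ∀ m : M, x • m ∈ N → m ∈ N)
    (hsurj : ∀ n, r ≤ n → ∀ m ∈ ℳ (n + 1), ∃ m' ∈ ℳ n, x • m' = m) :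
    ∃ d, ∀ n, d ≤ n → ∀ m ∈ ℳ n, m ∈ N → m = 0 := by
  let C : ℕ →o Submodule S M :=
    { toFun k := LinearMap.ker (LinearMap.lsmul S M (x ^ k))
      monotone' := by
        intro k l h m hm
        obtain ⟨j, rfl⟩ := Nat.exists_eq_add_of_le' h
        have hm' : x ^ k • m = 0 := hm
        change x ^ (j + k) • m = 0
        rw [pow_add, mul_smul, hm', smul_zero] }
  -- The kernels of the powers of `x` stabilize, so one exponent `K` kills all of `N`.
  obtain ⟨K, hK⟩ := monotone_stabilizes_iff_noetherian.2 ‹IsNoetherian S M› C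
  have hNK : ∀ m ∈ N, x ^ K • m = 0 := by
    intro m hm
    obtain ⟨k, hk⟩ := hN m hm
    have hmk : m ∈ C k := hk
    rcases le_total k K with h | h
    · exact C.monotone h hmk
    · rw [← hK k h] at hmk
      exact hmk
  have hpow : ∀ j, ∀ n, r ≤ n → ∀ m ∈ ℳ (n + j), ∃ m' ∈ ℳ n, x ^ j • m' = m := by
    intro j
    induction j with
    | zero => exact fun n _ m hm => ⟨m, hm, by simp⟩
    | succ j ih =>
      intro n hn m hm
      obtain ⟨m₁, hm₁, rfl⟩ := hsurj (n + j) (by omega) m hm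
      obtain ⟨m₂, hm₂, rfl⟩ := ih n hn m₁ hm₁
      exact ⟨m₂, hm₂, by rw [pow_succ', mul_smul]⟩
  have hpowN : ∀ j, ∀ m : M, x ^ j • m ∈ N → m ∈ N := by
    intro j
    induction j with
    | zero => exact fun m hm => by simpa using hm
    | succ j ih => exact fun m hm => ih m (hN' _ (by rwa [← mul_smul, ← pow_succ']))
  -- From degree `r + K` on, `m = x^K m'` with `m'` of degree at least `r`. Cancelling `x^K` puts
  -- `m'` in `N`, where `x^K` acts as zero.
  refine ⟨r + K, fun n hn m hm hmN => ?_⟩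
  obtain ⟨m', -, rfl⟩ := hpow K (n - K) (by omega) m (by rwa [Nat.sub_add_cancel (by omega)])
  exact hNK m' (hpowN K m' hmN)

end Torsion

end GradedReduction

open GradedReduction in
theorem lemma2p9 {A S M : Type*}
    [CommRing A] [IsArtinianRing A] [IsLocalRing A] [Infinite (IsLocalRing.ResidueField A)]
    [CommRing S] [Algebra A S] [Algebra.FiniteType A S]
    (𝒮 : ℕ → Submodule A S) [GradedAlgebra 𝒮]
    (h𝒮 : Algebra.adjoin A (𝒮 1 : Set S) = ⊤)
    [AddCommGroup M] [Module A M] [Module S M] [IsScalarTower A S M] [Module.Finite S M]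
    (ℳ : ℕ → Submodule A M) [DirectSum.Decomposition ℳ] [SetLike.GradedSMul 𝒮 ℳ]
    (hS₁ : ¬ (𝒮 1 : Set S) ⊆ ((Module.annihilator S M).radical : Set S))
    (hdim : Module.supportDim S M = 1) :
    (∀ n, GradedReduction.reductionNumber 𝒮 ℳ ≤ n →
      Module.length A (GradedReduction.starPiece 𝒮 ℳ n) =
        Module.length A
          (GradedReduction.starPiece 𝒮 ℳ (GradedReduction.reductionNumber 𝒮 ℳ))) ∧
    (∀ᶠ n in Filter.atTop,
      Module.length A (ℳ n) =
        Module.length A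
          (GradedReduction.starPiece 𝒮 ℳ (GradedReduction.reductionNumber 𝒮 ℳ))) := by
  have : IsNoetherianRing S := Algebra.FiniteType.isNoetherianRing A S
  have : IsNoetherian S M := isNoetherian_of_isNoetherianRing_of_finite S M
  -- Existence is needed for the infimum defining `r` to be attained, since `sInf ∅ = 0` in `ℕ`.
  obtain ⟨J₀, hJ₀⟩ := exists_isMinimalReduction (ℳ := ℳ) h𝒮 hdim.le hS₁
  obtain ⟨J, hJ, hr⟩ : reductionNumber 𝒮 ℳ ∈
      {r : ℕ | ∃ J : Ideal S, IsMinimalReduction 𝒮 ℳ J ∧ r = reductionNumberOf ℳ J} :=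
    Nat.sInf_mem ⟨_, J₀, hJ₀, rfl⟩
  set r := reductionNumber 𝒮 ℳ
  obtain ⟨x, hx, rfl, hrad⟩ := hJ.exists_eq_span_singleton h𝒮 hdim.le
  have hrmem : ∀ n, r ≤ n →
      piece ℳ (Ideal.span {x} • (⊤ : Submodule S M)) (n + 1) = ℳ (n + 1) := by
    rw [hr]
    refine Nat.sInf_mem (s := {n : ℕ | ∀ m, n ≤ m →
      piece ℳ (Ideal.span {x} • (⊤ : Submodule S M)) (m + 1) = ℳ (m + 1)}) ?_
    obtain ⟨d, hd⟩ := hJ.1.exists_forall_mem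
    exact ⟨d, fun n hn => piece_eq_iff.2 (hd (n + 1) (by omega))⟩
  have hsurj : ∀ n, r ≤ n → ∀ m ∈ ℳ (n + 1), ∃ m' ∈ ℳ n, x • m' = m := fun n hn m hm =>
    exists_smul_eq_of_mem_span_singleton_smul_top hx hm (piece_eq_iff.1 (hrmem n hn) m hm)
  have hxirr := HomogeneousIdeal.mem_irrelevant_of_mem 𝒮 one_pos hx
  have hmem : ∀ m : M, m ∈ zeroColonInfty (HomogeneousIdeal.irrelevant 𝒮).toIdeal M ↔
      ∃ K : ℕ, x ^ K • m = 0 := fun m => mem_zeroColonInfty_iff hxirr hrad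
  have hcancel : ∀ m : M, x • m ∈ zeroColonInfty (HomogeneousIdeal.irrelevant 𝒮).toIdeal M →
      m ∈ zeroColonInfty (HomogeneousIdeal.irrelevant 𝒮).toIdeal M := by
    intro m hm
    obtain ⟨K, hK⟩ := (hmem _).1 hm
    exact (hmem _).2 ⟨K + 1, by rwa [pow_succ, mul_smul]⟩
  have hconst : ∀ n, r ≤ n →
      Module.length A (starPiece 𝒮 ℳ n) = Module.length A (starPiece 𝒮 ℳ r) := by
    intro n hn
    induction n, hn using Nat.le_induction with
    | base => rfl
    | succ n hn ih => exact (length_quotientPiece_succ hx hcancel (hsurj n hn)).trans ih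
  refine ⟨hconst, ?_⟩
  obtain ⟨d, hd⟩ := exists_forall_mem_eq_zero (fun m => (hmem m).1) hcancel hsurj
  refine Filter.eventually_atTop.2 ⟨max d r, fun n hn => ?_⟩
  rw [← hconst n (le_of_max_le_right hn)]
  exact (length_quotientPiece_eq (hd n (le_of_max_le_left hn))).symm
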